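/- **Theorem 3.4 (colorful Erdős–Stone theorem).** A *bicolored graph* is a finite simple graph each of whose edges is colored red or blue. For real $\varepsilon>0$, a bicolored graph $G$ with $e(G)$ edges is *$\varepsilon$-balanced* if it has at least $\varepsilon\, e(G)$ red edges and at least $\varepsilon\, e(G)$ blue edges. A bicolored graph $G$ *contains* a bicolored graph $H$ if $G$ has a (not necessarily induced) subgraph isomorphic to $H$ by a color-preserving isomorphism. The *$t$-blow-up* of $H$ is obtained by replacing each vertex of $H$ by an independent set of $t$ vertices and each edge of $H$ by a complete bipartite graph of the same color. For a family $\mathcal F$ of bicolored graphs, let $\mathrm{ex}(\varepsilon,n,\mathcal F)$ be the maximum integer $M$ such that there is an $\varepsilon$-balanced bicolored graph on $n$ vertices with at least $M$ edges that contains no member of $\mathcal F$ (and $0$ if every $\varepsilon$-balanced bicolored graph on $n$ vertices contains a member of $\mathcal F$), and let $$\mathrm{ex}(\varepsilon,\mathcal F)=\lim_{n\to\infty}\frac{\mathrm{ex}(\varepsilon,n,\mathcal F)}{\binom n2}.$$ Let $\varepsilon>0$ and let $\mathcal F$ be a finite family of bicolored graphs. Then the limit $c=\mathrm{ex}(\varepsilon,\mathcal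 F)$ exists, and for every $\delta>0$ and every $t\in\mathbb N$ there is $N=N(\mathcal F,\varepsilon,\delta,t)$ such that for all $n\ge N$, every $\varepsilon$-balanced bicolored graph on $n$ vertices with at least $(c+\delta)\binom n2$ edges contains the $t$-blow-up of some $F\in\mathcal F$. -/

import Mathlib

open Filter Topology

/-- A bicolored graph on the vertex set `V`: a simple graph each of whose edges is either
red or blue, given by its (edge-disjoint) red and blue subgraphs. -/
structure BicoloredGraph (V : Type*) where
  /-- the graph of red edges -/
  red : SimpleGraph V
  /-- the graph of blue edges -/
  blue : SimpleGraph V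
  /-- no edge has both colors -/
  disjoint : Disjoint red blue

namespace BicoloredGraph

/-- The underlying uncolored graph. -/
def graph {V : Type*} (G : BicoloredGraph V) : SimpleGraph V := G.red ⊔ G.blue

/-- The number of edges `e(G)`. -/
noncomputable def numEdges {V : Type*} (G : BicoloredGraph V) : ℕ := G.graph.edgeSet.ncard

/-- `G` is `ε`-balanced if each color class has at least `ε * e(G)` edges. -/
def IsBalanced {V : Type*} (ε : ℝ) (G : BicoloredGraph V) : Prop :=
  ε * (G.numEdges : ℝ) ≤ (G.red.edgeSet.ncard : ℝ) ∧
    ε * (G.numEdges : ℝ) ≤ (G.blue.edgeSet.ncard : ℝ)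

/-- `G.Contains H`: `G` has a (not necessarily induced) subgraph that is a copy of `H`,
with the same colors. -/
def Contains {V W : Type*} (G : BicoloredGraph V) (H : BicoloredGraph W) : Prop :=
  ∃ f : W → V, Function.Injective f ∧
    (∀ u v : W, H.red.Adj u v → G.red.Adj (f u) (f v)) ∧
    (∀ u v : W, H.blue.Adj u v → G.blue.Adj (f u) (f v))

/-- The `t`-blow-up of `H`: each vertex is replaced by an independent set of size `t`, each edge
by a complete bipartite graph of the same color. -/
def blowUp {W : Type*} (H : BicoloredGraph W) (t : ℕ) : BicoloredGraph (W × Fin t) where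
  red := H.red.comap Prod.fst
  blue := H.blue.comap Prod.fst
  disjoint := by
    rw [disjoint_iff_inf_le]
    intro a b h
    exact (disjoint_iff_inf_le.mp H.disjoint) (show (H.red ⊓ H.blue).Adj a.1 b.1 from h)

end BicoloredGraph

/-- Finite bicolored graphs, on the vertex sets `Fin k`, `k : ℕ` (every finite bicolored graph
is isomorphic to one of these). -/
abbrev FinBicoloredGraph : Type := Σ k : ℕ, BicoloredGraph (Fin k)

/-- `ex(ε, n, 𝓕)`: the largest `M` such that some `ε`-balanced bicolored graph on `n` vertices with
at least `M` edges contains no member of `𝓕`. (The set below is bounded by `n.choose 2`; it is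
empty, and the value is then `0`, only if even the edgeless graph on `n` vertices contains a
member of `𝓕`.) -/
noncomputable def balancedEx (ε : ℝ) (n : ℕ) (𝓕 : Set FinBicoloredGraph) : ℕ :=
  sSup {M : ℕ | ∃ G : BicoloredGraph (Fin n),
    G.IsBalanced ε ∧ M ≤ G.numEdges ∧ ∀ F ∈ 𝓕, ¬ G.Contains F.2}

/-- `ex(ε, 𝓕)`: the limit of `ex(ε, n, 𝓕) / (n choose 2)` as `n → ∞`. -/
noncomputable def balancedExDensity (ε : ℝ) (𝓕 : Set FinBicoloredGraph) : ℝ :=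
  limUnder atTop (fun n : ℕ => (balancedEx ε n 𝓕 : ℝ) / (n.choose 2 : ℝ))

/-! Sampling plus supersaturation. Balance is not inherited by subgraphs, so edge densities cannot
simply be averaged over subsets. Instead, pull a balanced `G` on `n` vertices back along a random
map from `m` points. By a second-moment bound (`SimpleGraph.card_sparse_comap_le`) neither color
falls much below its expected density, and deleting surplus edges of the more frequent color
restores exact balance at small cost (`exists_balanced_subgraph`). So at least half of all maps are
injective and give a balanced `m`-vertex subgraph of nearly the density of `G`.

One such map shows that extremal densities satisfy `u n - η ≤ u m` for large `m` and `n` large in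
terms of `m`, which forces convergence. If `G` has density at least `c + δ`, fix `m` with `u m < c +
δ / 2`: half of all samples contain a member of `𝓕`. As `𝓕` is finite, pigeonhole gives one `F`
whose copies are a positive proportion of all `F.1`-tuples, and Erdős's box theorem for dense sets
of tuples yields the blow-up. -/

/-! ### Counting maps and the second moment -/

/-- A uniform random map restricted along an injection is again uniform; denominators are cleared.
-/
theorem sum_comp_mul_card_pow {α β V : Type*} [Fintype α] [Fintype β] [Fintype V]
    [DecidableEq α] [DecidableEq β] {ι : α → β} (hι : Function.Injective ι) (h : (α → V) → ℝ) :
    (∑ φ : β → V, h (φ ∘ ι)) * (Fintype.card V : ℝ) ^ Fintype.card α =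
      (Fintype.card V : ℝ) ^ Fintype.card β * ∑ ψ : α → V, h ψ := by
  classical
  let e : α ⊕ (↑(Set.range ι)ᶜ : Set β) ≃ β :=
    (Equiv.sumCongr (Equiv.ofInjective ι hι) (Equiv.refl _)).trans (Equiv.Set.sumCompl (Set.range ι))
  have he : ∀ a, e (Sum.inl a) = ι a := fun a => rfl
  have hcard : Fintype.card β = Fintype.card α + Fintype.card (↑(Set.range ι)ᶜ : Set β) := by
    rw [← Fintype.card_congr e, Fintype.card_sum]
  have hsum : ∑ φ : β → V, h (φ ∘ ι) =
      ∑ p : (α → V) × ((↑(Set.range ι)ᶜ : Set β) → V), h p.1 := by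
    refine Fintype.sum_equiv ((Equiv.arrowCongr e.symm (Equiv.refl V)).trans
      (Equiv.sumArrowEquivProdArrow _ _ _)) _ _ fun φ => ?_
    rfl
  rw [hsum, Fintype.sum_prod_type, hcard, pow_add]
  simp only [Finset.sum_const, Finset.card_univ, nsmul_eq_mul, Fintype.card_fun, Nat.cast_pow,
    ← Finset.mul_sum]
  ring

theorem card_not_injective_mul_card_le (α V : Type*) [Fintype α] [DecidableEq α]
    [Fintype V] [DecidablePred fun φ : α → V => Function.Injective φ] :
    ((Finset.univ.filter fun φ : α → V => ¬ Function.Injective φ).card : ℝ) * Fintype.card V ≤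
      (Fintype.card α : ℝ) ^ 2 * (Fintype.card V : ℝ) ^ Fintype.card α := by
  set k := Fintype.card α
  set n := Fintype.card V
  have htot : ((Finset.univ.filter fun φ : α → V => Function.Injective φ).card : ℝ) +
      ((Finset.univ.filter fun φ : α → V => ¬ Function.Injective φ).card : ℝ) = (n : ℝ) ^ k := by
    have := Finset.card_filter_add_card_filter_not (s := (Finset.univ : Finset (α → V)))
      (fun φ => Function.Injective φ)
    rw [Finset.card_univ, Fintype.card_fun] at this
    exact_mod_cast this
  have hnn : (0 : ℝ) ≤
    ((Finset.univ.filter fun φ : α → V => Function.Injective φ).card : ℝ) := by positivity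
  rcases lt_or_ge n k with hkn | hkn
  · have h1 : (n : ℝ) ≤ (k : ℝ) ^ 2 := by
      have : n ≤ k ^ 2 := by nlinarith
      exact_mod_cast this
    have h2 : (0 : ℝ) ≤ (n : ℝ) ^ k := by positivity
    nlinarith [Nat.cast_nonneg (α := ℝ) n]
  rcases Nat.eq_zero_or_pos n with hn | hn
  · rw [hn]; simp only [Nat.cast_zero, mul_zero]; positivity
  have hinj : ((Finset.univ.filter fun φ : α → V => Function.Injective φ).card) =
      n.descFactorial k := by
    rw [← Fintype.card_embedding_eq, ← Fintype.card_subtype]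
    exact Fintype.card_congr (Equiv.subtypeInjectiveEquivEmbedding α V)
  have hn' : (0 : ℝ) < n := by exact_mod_cast hn
  have hkn' : (k : ℝ) ≤ n := by exact_mod_cast hkn
  -- With Bernoulli's inequality this bounds the injective maps below by `n ^ k * (1 - k ^ 2 / n)`.
  have h1 : ((n : ℝ) - k) ^ k ≤ n.descFactorial k := by
    have := Nat.pow_sub_le_descFactorial n k
    calc ((n : ℝ) - k) ^ k ≤ ((n + 1 - k : ℕ) : ℝ) ^ k := by
          apply pow_le_pow_left₀ (by linarith)
          rw [Nat.cast_sub (by omega)]; push_cast; linarith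
      _ ≤ _ := by exact_mod_cast this
  have h2 : 1 + (k : ℝ) * (-(k / n)) ≤ (1 + -((k : ℝ) / n)) ^ k := by
    apply one_add_mul_le_pow
    have : (k : ℝ) / n ≤ 1 := (div_le_one hn').2 hkn'
    linarith
  have h3 : ((n : ℝ) - k) ^ k = n ^ k * (1 + -((k : ℝ) / n)) ^ k := by
    rw [← mul_pow]; congr 1; field_simp; ring
  have h4 : (n : ℝ) ^ k * (1 + (k : ℝ) * (-(k / n))) ≤ n.descFactorial k := by
    rw [h3] at h1
    exact (mul_le_mul_of_nonneg_left h2 (by positivity)).trans h1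
  have h5 : (n : ℝ) ^ k * (1 + (k : ℝ) * (-(k / n))) * n = n ^ k * (n - k ^ 2) := by
    field_simp; ring
  rw [hinj] at htot
  nlinarith

theorem sq_sum_eq_sum_comp_inl_mul_comp_inr {α X : Type*} [Fintype α] [DecidableEq α] [Fintype X]
    (g : (α → X) → ℝ) : (∑ q, g q) ^ 2 =
      ∑ q : α ⊕ α → X, g (q ∘ Sum.inl) * g (q ∘ Sum.inr) := by
  rw [sq, Finset.sum_mul_sum, ← Fintype.sum_prod_type']
  exact (Fintype.sum_equiv (Equiv.sumArrowEquivProdArrow α α X) _ _ fun q => rfl).symm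

/-- Expand the square over pairs of tuples: a jointly injective pair gives independent factors of
mean zero, and the few other pairs contribute at most one each on average. -/
theorem sum_sq_sum_comp_le {α β V : Type*} [Fintype α] [Fintype β] [Fintype V] [Nonempty V]
    [DecidableEq α] [DecidableEq β]
    (f : (α → V) → ℝ) (hf : ∀ q, |f q| ≤ 1) (hf0 : ∑ q, f q = 0) :
    (∑ φ : β → V, (∑ q : α → β, f (φ ∘ q)) ^ 2) * Fintype.card β ≤
      (2 * Fintype.card α : ℝ) ^ 2 * (Fintype.card β : ℝ) ^ (2 * Fintype.card α) *
        (Fintype.card V : ℝ) ^ Fintype.card β := by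
  classical
  have hT : ∀ q : α ⊕ α → β,
      ∑ φ : β → V, f ((φ ∘ q) ∘ Sum.inl) * f ((φ ∘ q) ∘ Sum.inr) ≤
        if Function.Injective q then 0 else (Fintype.card V : ℝ) ^ Fintype.card β := by
    intro q
    split_ifs with hq
    · have := sum_comp_mul_card_pow hq
        (fun p : α ⊕ α → V => f (p ∘ Sum.inl) * f (p ∘ Sum.inr))
      rw [← sq_sum_eq_sum_comp_inl_mul_comp_inr, hf0] at this
      have hV : (Fintype.card V : ℝ) ^ Fintype.card (α ⊕ α) ≠ 0 := by
        have := Fintype.card_pos (α := V)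
        positivity
      have h0 := (mul_eq_zero.1 (this.trans (by ring))).resolve_right hV
      exact h0.le
    · calc _ ≤ ∑ φ : β → V, (1 : ℝ) := by
            refine Finset.sum_le_sum fun φ _ => (le_abs_self _).trans ?_
            rw [abs_mul]
            exact mul_le_one₀ (hf _) (abs_nonneg _) (hf _)
        _ = _ := by simp
  have hsum : ∑ φ : β → V, (∑ q : α → β, f (φ ∘ q)) ^ 2 ≤
      (Finset.univ.filter fun q : α ⊕ α → β => ¬ Function.Injective q).card *
        (Fintype.card V : ℝ) ^ Fintype.card β := by
    simp_rw [sq_sum_eq_sum_comp_inl_mul_comp_inr fun q : α → β => f (_ ∘ q)]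
    rw [Finset.sum_comm]
    refine (Finset.sum_le_sum fun q _ => hT q).trans ?_
    rw [Finset.sum_ite]
    simp
  have hni := card_not_injective_mul_card_le (α ⊕ α) β
  rw [Fintype.card_sum, Nat.cast_add, ← two_mul, ← two_mul] at hni
  have hV : (0 : ℝ) ≤ (Fintype.card V : ℝ) ^ Fintype.card β := by positivity
  have hβ : (0 : ℝ) ≤ Fintype.card β := by positivity
  have h1 := mul_le_mul_of_nonneg_right hsum hβ
  have h2 := mul_le_mul_of_nonneg_right hni hV
  rw [mul_right_comm] at h1
  exact h1.trans h2

open Classical in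
theorem SimpleGraph.sum_adj_eq_two_mul_ncard {V : Type*} [Fintype V] (G : SimpleGraph V) :
    ∑ q : Fin 2 → V, (if G.Adj (q 0) (q 1) then (1 : ℝ) else 0) = 2 * G.edgeSet.ncard := by
  have h1 : ∑ q : Fin 2 → V, (if G.Adj (q 0) (q 1) then (1 : ℝ) else 0) =
      ∑ v : V, ∑ w : V, (if G.Adj v w then (1 : ℝ) else 0) := by
    rw [← Fintype.sum_prod_type']
    exact Fintype.sum_equiv (finTwoArrowEquiv V) _ _ fun q => rfl
  have h2 := G.sum_degrees_eq_twice_card_edges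
  rw [h1, Set.ncard_eq_toFinset_card', Set.toFinset_card, ← SimpleGraph.edgeFinset_card]
  have h3 : ∀ v, ∑ w : V, (if G.Adj v w then (1 : ℝ) else 0) = G.degree v := by
    intro v
    rw [← SimpleGraph.card_neighborFinset_eq_degree, SimpleGraph.neighborFinset_eq_filter]
    simp
  simp_rw [h3]
  exact_mod_cast h2

-- Chebyshev's inequality for the adjacency indicator minus its mean `2 * d` over ordered pairs.
open Classical in
theorem SimpleGraph.card_sparse_comap_le {V : Type*} [Fintype V] [Nonempty V] (G : SimpleGraph V)
    {η : ℝ} (hη : 0 < η) (m : ℕ) :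
    ((Finset.univ.filter fun φ : Fin m → V => ((G.comap φ).edgeSet.ncard : ℝ) <
      (m : ℝ) ^ 2 * (G.edgeSet.ncard / (Fintype.card V : ℝ) ^ 2) - η * (m : ℝ) ^ 2).card : ℝ) *
        (η ^ 2 * m) ≤ 4 * (Fintype.card V : ℝ) ^ m := by
  rcases Nat.eq_zero_or_pos m with rfl | hm
  · simp
  have hm' : (0 : ℝ) < m := by exact_mod_cast hm
  set n : ℝ := (Fintype.card V : ℝ) with hn
  have hn0 : 0 < n := by rw [hn]; exact_mod_cast Fintype.card_pos (α := V)
  set d : ℝ := G.edgeSet.ncard / n ^ 2 with hd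
  have hd0 : 0 ≤ d := by positivity
  have hdn : d * n ^ 2 = G.edgeSet.ncard := by rw [hd]; field_simp
  have hd1 : 2 * d ≤ 1 := by
    have h := G.sum_adj_eq_two_mul_ncard
    have h' : ∑ q : Fin 2 → V, (if G.Adj (q 0) (q 1) then (1 : ℝ) else 0) ≤ n ^ 2 := by
      calc _ ≤ ∑ q : Fin 2 → V, (1 : ℝ) := by
            gcongr; split_ifs <;> norm_num
        _ = n ^ 2 := by simp [hn]
    rw [h, ← hdn] at h'
    have : 0 < n ^ 2 := by positivity
    nlinarith
  let f : (Fin 2 → V) → ℝ := fun q => (if G.Adj (q 0) (q 1) then (1 : ℝ) else 0) - 2 * d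
  have hf : ∀ q, |f q| ≤ 1 := by
    intro q
    simp only [f]
    split_ifs <;> rw [abs_le] <;> constructor <;> linarith
  have hf0 : ∑ q, f q = 0 := by
    simp only [f, Finset.sum_sub_distrib, G.sum_adj_eq_two_mul_ncard]
    simp only [Finset.sum_const, Finset.card_univ, Fintype.card_fun, Fintype.card_fin, nsmul_eq_mul]
    push_cast
    rw [← hdn]; ring
  have hS : ∀ φ : Fin m → V, ∑ q : Fin 2 → Fin m, f (φ ∘ q) =
      2 * (G.comap φ).edgeSet.ncard - m ^ 2 * (2 * d) := by
    intro φ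
    rw [← (G.comap φ).sum_adj_eq_two_mul_ncard]
    simp only [f, Finset.sum_sub_distrib, SimpleGraph.comap_adj, Function.comp_apply]
    simp
  have key := sum_sq_sum_comp_le (β := Fin m) f hf hf0
  simp_rw [hS] at key
  simp only [Fintype.card_fin] at key
  set B := Finset.univ.filter fun φ : Fin m → V => ((G.comap φ).edgeSet.ncard : ℝ) <
      (m : ℝ) ^ 2 * d - η * (m : ℝ) ^ 2
  have hB : (B.card : ℝ) * (4 * η ^ 2 * m ^ 4) ≤
      ∑ φ : Fin m → V, (2 * ((G.comap φ).edgeSet.ncard : ℝ) - m ^ 2 * (2 * d)) ^ 2 := by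
    rw [← nsmul_eq_mul, ← Finset.sum_const]
    refine le_trans (Finset.sum_le_sum fun φ hφ => ?_)
      (Finset.sum_le_sum_of_subset_of_nonneg (Finset.subset_univ B) fun _ _ _ => sq_nonneg _)
    have := (Finset.mem_filter.1 hφ).2
    have h2 : 0 ≤ η * (m : ℝ) ^ 2 := by positivity
    nlinarith
  have h3 := (mul_le_mul_of_nonneg_right hB hm'.le).trans key
  have h4 : (m : ℝ) ^ 4 * (4 * ((B.card : ℝ) * (η ^ 2 * m))) ≤ m ^ 4 * (4 * (4 * n ^ m)) := by
    calc _ = (B.card : ℝ) * (4 * η ^ 2 * m ^ 4) * m := by ring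
      _ ≤ _ := h3
      _ = _ := by push_cast; ring
  have := le_of_mul_le_mul_left h4 (by positivity)
  linarith

/-! ### Restoring balance -/

namespace BicoloredGraph

variable {V W : Type*}

/-- The pullback of a bicolored graph along a map of vertex sets. -/
def comap (φ : W → V) (G : BicoloredGraph V) : BicoloredGraph W where
  red := G.red.comap φ
  blue := G.blue.comap φ
  disjoint := by
    rw [disjoint_iff_inf_le]
    intro a b h
    exact (disjoint_iff_inf_le.mp G.disjoint) (show (G.red ⊓ G.blue).Adj (φ a) (φ b) from h)

theorem numEdges_eq_add [Finite V] (G : BicoloredGraph V) :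
    G.numEdges = G.red.edgeSet.ncard + G.blue.edgeSet.ncard := by
  rw [numEdges, graph, SimpleGraph.edgeSet_sup]
  exact Set.ncard_union_eq (SimpleGraph.disjoint_edgeSet.2 G.disjoint)

theorem numEdges_le_choose (n : ℕ) (G : BicoloredGraph (Fin n)) : G.numEdges ≤ n.choose 2 := by
  classical
  have := G.graph.card_edgeFinset_le_card_choose_two
  rw [Fintype.card_fin] at this
  rwa [numEdges, Set.ncard_eq_toFinset_card', Set.toFinset_card, ← SimpleGraph.edgeFinset_card]

/-- The bicolored graph obtained by exchanging the colors. -/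
def swap (G : BicoloredGraph V) : BicoloredGraph V := ⟨G.blue, G.red, G.disjoint.symm⟩

theorem _root_.SimpleGraph.exists_le_ncard_edgeSet_eq [Finite V] (G : SimpleGraph V) {k : ℕ}
    (hk : k ≤ G.edgeSet.ncard) : ∃ H ≤ G, H.edgeSet.ncard = k := by
  obtain ⟨s, hs, rfl⟩ := Set.exists_subset_card_eq hk
  have hse : (SimpleGraph.fromEdgeSet s).edgeSet = s := by
    rw [SimpleGraph.edgeSet_fromEdgeSet, sdiff_eq_left, Set.disjoint_left]
    intro e he
    exact G.not_isDiag_of_mem_edgeSet (hs he)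
  refine ⟨SimpleGraph.fromEdgeSet s, ?_, by rw [hse]⟩
  rw [← SimpleGraph.edgeSet_subset_edgeSet, hse]
  exact hs

theorem exists_balanced_subgraph_of_red_le_blue [Finite V] {ε s : ℝ} (hε : 0 < ε) (hε' : ε ≤ 1 / 2)
    (G : BicoloredGraph V) (hrb : G.red.edgeSet.ncard ≤ G.blue.edgeSet.ncard)
    (hr : ε * s ≤ G.red.edgeSet.ncard) (hs : s ≤ G.numEdges) :
    ∃ H : BicoloredGraph V, H.red ≤ G.red ∧ H.blue ≤ G.blue ∧ H.IsBalanced ε ∧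
      s - 1 ≤ H.numEdges := by
  rw [numEdges_eq_add] at hs
  set r := G.red.edgeSet.ncard with hrdef
  set b := G.blue.edgeSet.ncard
  -- The largest number of blue edges, up to `b`, for which red keeps an `ε` share. If the floor is
  -- the minimum, the total exceeds `r / ε - 1 ≥ s - 1`.
  set k : ℕ := min b ⌊(r : ℝ) * ((1 - ε) / ε)⌋₊ with hk
  have hr0 : (0 : ℝ) ≤ r := Nat.cast_nonneg r
  have hκ : 1 ≤ (1 - ε) / ε := by rw [le_div_iff₀ hε]; linarith
  have hrk : r ≤ k := by
    refine le_min hrb (Nat.le_floor ?_)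
    nlinarith
  have hkr : ε * k ≤ (1 - ε) * r := by
    have h1 : (k : ℝ) ≤ (r : ℝ) * ((1 - ε) / ε) :=
      le_trans (by exact_mod_cast min_le_right _ _) (Nat.floor_le (by positivity))
    have h2 := mul_le_mul_of_nonneg_left h1 hε.le
    have h3 : ε * ((r : ℝ) * ((1 - ε) / ε)) = (1 - ε) * r := by field_simp
    linarith
  obtain ⟨B, hB, hBk⟩ := G.blue.exists_le_ncard_edgeSet_eq (min_le_left b _ : k ≤ b)
  change B.edgeSet.ncard = k at hBk
  clear_value k
  have hrk' : (r : ℝ) ≤ k := by exact_mod_cast hrk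
  refine ⟨⟨G.red, B, G.disjoint.mono_right hB⟩, le_rfl, hB, ?_, ?_⟩
  · rw [IsBalanced, numEdges_eq_add]
    simp only [hBk, ← hrdef]
    push_cast
    constructor <;> nlinarith
  · rw [numEdges_eq_add]
    simp only [hBk, ← hrdef]
    push_cast at hs ⊢
    rcases min_choice b ⌊(r : ℝ) * ((1 - ε) / ε)⌋₊ with h | h
    · rw [hk, h]; linarith
    · have h1 := Nat.lt_floor_add_one ((r : ℝ) * ((1 - ε) / ε))
      rw [hk, h]
      have h2 : s ≤ r / ε := by rw [le_div_iff₀ hε]; linarith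
      have h3 : (r : ℝ) / ε = r + r * ((1 - ε) / ε) := by field_simp; ring
      linarith

theorem exists_balanced_subgraph [Finite V] {ε s : ℝ} (hε : 0 < ε) (hε' : ε ≤ 1 / 2)
    (G : BicoloredGraph V) (hr : ε * s ≤ G.red.edgeSet.ncard)
    (hb : ε * s ≤ G.blue.edgeSet.ncard) (hs : s ≤ G.numEdges) :
    ∃ H : BicoloredGraph V, H.red ≤ G.red ∧ H.blue ≤ G.blue ∧ H.IsBalanced ε ∧
      s - 1 ≤ H.numEdges := by
  rcases le_total G.red.edgeSet.ncard G.blue.edgeSet.ncard with h | h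
  · exact exists_balanced_subgraph_of_red_le_blue hε hε' G h hr hs
  · obtain ⟨H, h1, h2, h3, h4⟩ := exists_balanced_subgraph_of_red_le_blue (s := s) hε hε' G.swap h hb
      (by rw [numEdges_eq_add] at hs ⊢; rw [add_comm]; exact hs)
    have hH : H.swap.numEdges = H.numEdges := by
      rw [numEdges_eq_add, numEdges_eq_add, add_comm]; rfl
    refine ⟨H.swap, h2, h1, ?_, by rwa [hH]⟩
    rw [IsBalanced, hH]
    exact ⟨h3.2, h3.1⟩

theorem IsBalanced.numEdges_eq_zero [Finite V] {ε : ℝ} (hε : 1 / 2 < ε) {G : BicoloredGraph V}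
    (hG : G.IsBalanced ε) : G.numEdges = 0 := by
  obtain ⟨h1, h2⟩ := hG
  have h := G.numEdges_eq_add
  have h' : (G.numEdges : ℝ) = G.red.edgeSet.ncard + G.blue.edgeSet.ncard := by exact_mod_cast h
  have h0 : (0 : ℝ) ≤ G.numEdges := Nat.cast_nonneg _
  have : (G.numEdges : ℝ) = 0 := by nlinarith
  exact_mod_cast this

end BicoloredGraph

/-! ### Boxes in dense sets of tuples -/

/-- A positive proportion of all `k`-tuples contains a box with all sides of size `t`. -/
theorem eventually_exists_box_subset (k t : ℕ) {γ : ℝ} (hγ : 0 < γ) :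
    ∀ᶠ n : ℕ in atTop, ∀ A : Finset (Fin k → Fin n), γ * (n : ℝ) ^ k ≤ A.card →
      ∃ g : Fin k → Fin t → Fin n, (∀ i, Function.Injective (g i)) ∧
        ∀ τ : Fin k → Fin t, (fun i => g i (τ i)) ∈ A := by
  induction k generalizing γ with
  | zero =>
    refine Eventually.of_forall fun n A hA => ⟨fun i => i.elim0, fun i => i.elim0, fun τ => ?_⟩
    have : 0 < A.card := by
      have : (0 : ℝ) < A.card := lt_of_lt_of_le (by simpa using hγ) hA
      exact_mod_cast this
    obtain ⟨a, ha⟩ := Finset.card_pos.1 this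
    convert ha
  | succ k ih =>
    have hγt : 0 < γ ^ t / 2 := by positivity
    filter_upwards [ih hγt, eventually_gt_atTop 0,
      tendsto_natCast_atTop_atTop.eventually_ge_atTop ((t : ℝ) ^ 2 / (γ ^ t / 2))]
      with n hn hn0 hnt A hA
    have hn0' : (0 : ℝ) < n := by exact_mod_cast hn0
    let D : (Fin k → Fin n) → Finset (Fin n) := fun y =>
      Finset.univ.filter fun x => (Fin.cons x y : Fin (k + 1) → Fin n) ∈ A
    let E : (Fin t → Fin n) → Finset (Fin k → Fin n) := fun ψ =>
      Finset.univ.filter fun y => ∀ j, (Fin.cons (ψ j) y : Fin (k + 1) → Fin n) ∈ A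
    have hD : ∑ y, ((D y).card : ℝ) = A.card := by
      have h1 : (A.card : ℝ) = ∑ z : Fin (k + 1) → Fin n, if z ∈ A then 1 else 0 := by simp
      rw [h1, ← (Fin.consEquiv fun _ => Fin n).sum_comp, Fintype.sum_prod_type, Finset.sum_comm]
      refine Finset.sum_congr rfl fun y _ => ?_
      rw [Finset.sum_boole]
      rfl
    have hDE : ∑ y, ((D y).card : ℝ) ^ t = ∑ ψ, ((E ψ).card : ℝ) := by
      have h1 : ∀ y, ((D y).card : ℝ) ^ t = ∑ ψ : Fin t → Fin n,
          if (∀ j, (Fin.cons (ψ j) y : Fin (k + 1) → Fin n) ∈ A) then 1 else 0 := by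
        intro y
        have : (Finset.univ.filter fun ψ : Fin t → Fin n =>
            ∀ j, (Fin.cons (ψ j) y : Fin (k + 1) → Fin n) ∈ A) =
            Fintype.piFinset fun _ : Fin t => D y := by
          ext ψ; simp [D]
        rw [Finset.sum_boole, this, Fintype.card_piFinset]
        simp
      simp_rw [h1]
      rw [Finset.sum_comm]
      refine Finset.sum_congr rfl fun ψ _ => ?_
      simp [E]
    -- Power mean inequality: the average size of `E ψ` is at least `γ ^ t * n ^ k`. Non-injective
    -- `ψ` account for at most half of this, so some injective `ψ` admits the induction hypothesis.
    have hpow : (n : ℝ) ^ k * (γ * n) ^ t ≤ ∑ y, ((D y).card : ℝ) ^ t := by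
      rcases t with _ | t
      · simp
      have hm := pow_sum_div_card_le_sum_pow (s := Finset.univ) (f := fun y => ((D y).card : ℝ))
        (fun _ _ => Nat.cast_nonneg _) t
      refine le_trans ?_ hm
      rw [hD, le_div_iff₀ (by simp; positivity)]
      calc (n : ℝ) ^ k * (γ * n) ^ (t + 1) * ((Finset.univ : Finset (Fin k → Fin n)).card : ℝ) ^ t
          = (γ * (n : ℝ) ^ (k + 1)) ^ (t + 1) := by simp; ring
        _ ≤ _ := by gcongr
    classical
    by_contra hcon
    have hE : ∀ ψ, Function.Injective ψ → ((E ψ).card : ℝ) < γ ^ t / 2 * (n : ℝ) ^ k := by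
      intro ψ hψ
      by_contra hlt
      obtain ⟨g, hg, hgE⟩ := hn (E ψ) (not_lt.1 hlt)
      refine hcon ⟨Fin.cons ψ g, fun i => ?_, fun τ => ?_⟩
      · refine Fin.cases ?_ (fun i => ?_) i
        · simpa using hψ
        · simpa using hg i
      · have h1 := (Finset.mem_filter.1 (hgE (Fin.tail τ))).2 (τ 0)
        convert h1 using 1
        ext i
        refine Fin.cases ?_ (fun i => ?_) i <;> simp [Fin.tail]
    have hni := card_not_injective_mul_card_le (Fin t) (Fin n)
    simp only [Fintype.card_fin] at hni
    set B := Finset.univ.filter fun ψ : Fin t → Fin n => ¬ Function.Injective ψ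
    have hB : (B.card : ℝ) ≤ γ ^ t / 2 * n ^ t := by
      have h2 : (t : ℝ) ^ 2 ≤ n * (γ ^ t / 2) := (div_le_iff₀ hγt).1 hnt
      have h3 : (t : ℝ) ^ 2 * n ^ t ≤ n * (γ ^ t / 2) * n ^ t := by gcongr
      have h4 : (B.card : ℝ) * n ≤ γ ^ t / 2 * n ^ t * n := by linarith
      exact le_of_mul_le_mul_right h4 hn0'
    have hsum : ∑ ψ, ((E ψ).card : ℝ) <
        ∑ ψ : Fin t → Fin n, γ ^ t / 2 * (n : ℝ) ^ k + B.card * (n : ℝ) ^ k := by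
      have h1 : (B.card : ℝ) * (n : ℝ) ^ k =
          ∑ ψ : Fin t → Fin n, if ¬ Function.Injective ψ then (n : ℝ) ^ k else 0 := by
        rw [← Finset.sum_filter]; simp [B]
      rw [h1, ← Finset.sum_add_distrib]
      have : Nonempty (Fin n) := ⟨⟨0, hn0⟩⟩
      refine Finset.sum_lt_sum_of_nonempty Finset.univ_nonempty fun ψ _ => ?_
      by_cases hψ : Function.Injective ψ <;>
        simp only [hψ, not_true_eq_false, not_false_eq_true, if_true, if_false]
      · rw [add_zero]; exact hE ψ hψ
      · have h2 : (E ψ).card ≤ n ^ k := by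
          simpa using Finset.card_le_univ (E ψ)
        have h3 : ((E ψ).card : ℝ) ≤ (n : ℝ) ^ k := by exact_mod_cast h2
        have h4 : 0 < γ ^ t / 2 * (n : ℝ) ^ k := by positivity
        linarith
    rw [← hDE] at hsum
    have h5 : ∑ ψ : Fin t → Fin n, γ ^ t / 2 * (n : ℝ) ^ k = n ^ t * (γ ^ t / 2 * n ^ k) := by simp
    have h6 : (B.card : ℝ) * (n : ℝ) ^ k ≤ γ ^ t / 2 * n ^ t * n ^ k := by gcongr
    rw [mul_pow] at hpow
    linarith

/-! ### Sampling balanced graphs -/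

namespace BicoloredGraph

variable {V W U : Type*}

theorem Contains.of_le_comap {G : BicoloredGraph V} {H : BicoloredGraph W} {F : BicoloredGraph U}
    {φ : W → V} (hφ : Function.Injective φ) (hr : H.red ≤ (G.comap φ).red)
    (hb : H.blue ≤ (G.comap φ).blue) (h : H.Contains F) : G.Contains F := by
  obtain ⟨f, hf, h1, h2⟩ := h
  exact ⟨φ ∘ f, hφ.comp hf, fun u v huv => hr (h1 u v huv), fun u v huv => hb (h2 u v huv)⟩

theorem exists_balanced_subgraph_of_not_sparse {n m : ℕ} {ε η : ℝ} (hε : 0 < ε) (hη : 0 < η)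
    (hm : 2 ≤ m) (hmη : 8 / η ≤ m) (hmn : m ≤ n) {G : BicoloredGraph (Fin n)}
    (hG : G.IsBalanced ε) (φ : Fin m → Fin n)
    (hr : (m : ℝ) ^ 2 * (G.red.edgeSet.ncard / (n : ℝ) ^ 2) - ε * η / 8 * (m : ℝ) ^ 2 ≤
      (G.red.comap φ).edgeSet.ncard)
    (hb : (m : ℝ) ^ 2 * (G.blue.edgeSet.ncard / (n : ℝ) ^ 2) - ε * η / 8 * (m : ℝ) ^ 2 ≤
      (G.blue.comap φ).edgeSet.ncard) :
    ∃ H : BicoloredGraph (Fin m), H.red ≤ (G.comap φ).red ∧ H.blue ≤ (G.comap φ).blue ∧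
      H.IsBalanced ε ∧
      ((G.numEdges : ℝ) / n.choose 2 - η) * m.choose 2 ≤ H.numEdges := by
  rcases lt_or_ge (1 / 2) ε with hε' | hε'
  · refine ⟨⟨⊥, ⊥, disjoint_bot_left⟩, bot_le, bot_le, ?_, ?_⟩
    · simp [IsBalanced, numEdges_eq_add]
    · rw [hG.numEdges_eq_zero hε']
      have : 0 ≤ η * (m.choose 2 : ℝ) := by positivity
      simp only [Nat.cast_zero, zero_div, zero_sub, neg_mul]
      exact (neg_nonpos.2 this).trans (Nat.cast_nonneg _)
  · have hm' : (2 : ℝ) ≤ m := by exact_mod_cast hm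
    have hmn' : (m : ℝ) ≤ n := by exact_mod_cast hmn
    have hn0 : (0 : ℝ) < n := by linarith
    have he : (G.numEdges : ℝ) = G.red.edgeSet.ncard + G.blue.edgeSet.ncard := by
      exact_mod_cast G.numEdges_eq_add
    set e : ℝ := (G.numEdges : ℝ)
    set r : ℝ := (G.red.edgeSet.ncard : ℝ)
    set b : ℝ := (G.blue.edgeSet.ncard : ℝ)
    have he0 : 0 ≤ e := Nat.cast_nonneg _
    set q : ℝ := (m : ℝ) ^ 2 / (n : ℝ) ^ 2 with hq
    have hq0 : 0 ≤ q := by positivity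
    have hqx : ∀ x : ℝ, (m : ℝ) ^ 2 * (x / (n : ℝ) ^ 2) = q * x := fun x => by rw [hq]; ring
    rw [hqx] at hr hb
    have hm2 : 0 < η * (m : ℝ) ^ 2 := by positivity
    -- The error `ε * η / 8` per color is exactly what this `s` tolerates; the two errors add up to
    -- at most `η / 8` as `ε ≤ 1 / 2`.
    obtain ⟨H, h1, h2, h3, h4⟩ := exists_balanced_subgraph (s := q * e - η * m ^ 2 / 8) hε hε'
      (G.comap φ) (by
        refine le_trans ?_ hr
        have := mul_le_mul_of_nonneg_left hG.1 hq0
        linarith) (by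
        refine le_trans ?_ hb
        have := mul_le_mul_of_nonneg_left hG.2 hq0
        linarith) (by
        rw [numEdges_eq_add]
        push_cast
        refine le_trans ?_ (add_le_add hr hb)
        rw [he]
        nlinarith)
    refine ⟨H, h1, h2, h3, le_trans ?_ h4⟩
    rw [Nat.cast_choose_two, Nat.cast_choose_two]
    have hm8 : 1 ≤ η * (m : ℝ) ^ 2 / 8 := by
      rw [div_le_iff₀ hη] at hmη
      nlinarith
    have hqe : e / (n * (n - 1) / 2) * (m * (m - 1) / 2) ≤ q * e := by
      have h5 : (m : ℝ) * (m - 1) / (n * (n - 1)) ≤ q := by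
        rw [hq, div_le_div_iff₀ (by nlinarith) (by positivity)]
        have h6 : ((m : ℝ) - 1) * n ≤ m * (n - 1) := by linarith
        have h7 : 0 ≤ (m : ℝ) * n := by positivity
        nlinarith [mul_le_mul_of_nonneg_left h6 h7]
      have h8 : (n : ℝ) - 1 ≠ 0 := by linarith
      have h9 : e / (n * (n - 1) / 2) * (m * (m - 1) / 2) = m * (m - 1) / (n * (n - 1)) * e := by
        field_simp
      rw [h9]
      exact mul_le_mul_of_nonneg_right h5 he0
    nlinarith

open Classical in
/-- Most maps from a large set of bounded size into the vertices of a balanced graph pull it back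
to a graph with a balanced subgraph of nearly the same density. -/
theorem eventually_half_le_card_dense_comap {ε η : ℝ} (hε : 0 < ε) (hη : 0 < η) :
    ∀ᶠ m : ℕ in atTop, ∀ᶠ n : ℕ in atTop, ∀ G : BicoloredGraph (Fin n), G.IsBalanced ε →
      (n : ℝ) ^ m / 2 ≤ (Finset.univ.filter fun φ : Fin m → Fin n => Function.Injective φ ∧
        ∃ H : BicoloredGraph (Fin m), H.red ≤ (G.comap φ).red ∧ H.blue ≤ (G.comap φ).blue ∧
          H.IsBalanced ε ∧
          ((G.numEdges : ℝ) / n.choose 2 - η) * m.choose 2 ≤ H.numEdges).card := by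
  set η₀ := ε * η / 8 with hη₀
  have hη0 : 0 < η₀ := by positivity
  filter_upwards [eventually_ge_atTop 2,
    tendsto_natCast_atTop_atTop.eventually_ge_atTop (8 / η),
    tendsto_natCast_atTop_atTop.eventually_ge_atTop (32 / η₀ ^ 2)] with m hm hmη hmη0
  filter_upwards [eventually_ge_atTop m, eventually_ge_atTop (4 * m ^ 2)] with n hmn hn4 G hG
  have : Nonempty (Fin n) := ⟨⟨0, by omega⟩⟩
  have hn0 : (0 : ℝ) < n := by exact_mod_cast (by omega : 0 < n)
  have hN : 0 < (n : ℝ) ^ m := by positivity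
  -- Bad maps: an eighth for each color and a quarter for non-injectivity, half in all.
  have hsparse : ∀ x : ℝ, 0 ≤ x → x * (η₀ ^ 2 * m) ≤ 4 * (n : ℝ) ^ m → x ≤ (n : ℝ) ^ m / 8 := by
    intro x hx h
    rw [div_le_iff₀ (by positivity)] at hmη0
    nlinarith
  have h1 := hsparse _ (Nat.cast_nonneg _)
    (by simpa only [Fintype.card_fin] using G.red.card_sparse_comap_le hη0 m)
  have h2 := hsparse _ (Nat.cast_nonneg _)
    (by simpa only [Fintype.card_fin] using G.blue.card_sparse_comap_le hη0 m)
  have h3 := card_not_injective_mul_card_le (Fin m) (Fin n)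
  simp only [Fintype.card_fin] at h3
  set B₁ := Finset.univ.filter fun φ : Fin m → Fin n => ((G.red.comap φ).edgeSet.ncard : ℝ) <
      (m : ℝ) ^ 2 * (G.red.edgeSet.ncard / (n : ℝ) ^ 2) - η₀ * (m : ℝ) ^ 2
  set B₂ := Finset.univ.filter fun φ : Fin m → Fin n => ((G.blue.comap φ).edgeSet.ncard : ℝ) <
      (m : ℝ) ^ 2 * (G.blue.edgeSet.ncard / (n : ℝ) ^ 2) - η₀ * (m : ℝ) ^ 2
  set B₃ := Finset.univ.filter fun φ : Fin m → Fin n => ¬ Function.Injective φ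
  have h4 : (B₃.card : ℝ) ≤ (n : ℝ) ^ m / 4 := by
    have h5 : (4 * m ^ 2 : ℝ) ≤ n := by exact_mod_cast hn4
    have h6 : (m : ℝ) ^ 2 * n ^ m ≤ (n ^ m / 4) * n := by nlinarith
    exact le_of_mul_le_mul_right (h3.trans h6) hn0
  set S := Finset.univ.filter fun φ : Fin m → Fin n => Function.Injective φ ∧
        ∃ H : BicoloredGraph (Fin m), H.red ≤ (G.comap φ).red ∧ H.blue ≤ (G.comap φ).blue ∧
          H.IsBalanced ε ∧
          ((G.numEdges : ℝ) / n.choose 2 - η) * m.choose 2 ≤ H.numEdges with hS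
  have hcover : (Finset.univ : Finset (Fin m → Fin n)) ⊆ B₁ ∪ B₂ ∪ B₃ ∪ S := by
    intro φ _
    by_contra hφ
    simp only [Finset.mem_union, not_or] at hφ
    obtain ⟨⟨⟨hφ1, hφ2⟩, hφ3⟩, hφ4⟩ := hφ
    have hφ1' : ¬ _ := fun h => hφ1 (Finset.mem_filter.2 ⟨Finset.mem_univ φ, h⟩)
    have hφ2' : ¬ _ := fun h => hφ2 (Finset.mem_filter.2 ⟨Finset.mem_univ φ, h⟩)
    have hφ3' : Function.Injective φ := by
      by_contra h
      exact hφ3 (Finset.mem_filter.2 ⟨Finset.mem_univ φ, h⟩)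
    exact hφ4 (Finset.mem_filter.2 ⟨Finset.mem_univ φ, hφ3',
      exists_balanced_subgraph_of_not_sparse hε hη hm hmη hmn hG φ (not_lt.1 hφ1') (not_lt.1 hφ2')⟩)
  have hle : n ^ m ≤ B₁.card + B₂.card + B₃.card + S.card := by
    have h7 := Finset.card_le_card hcover
    rw [Finset.card_univ, Fintype.card_fun, Fintype.card_fin, Fintype.card_fin] at h7
    have h8 := Finset.card_union_le (B₁ ∪ B₂ ∪ B₃) S
    have h9 := Finset.card_union_le (B₁ ∪ B₂) B₃
    have h10 := Finset.card_union_le B₁ B₂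
    omega
  have hle' : (n : ℝ) ^ m ≤ B₁.card + B₂.card + B₃.card + S.card := by exact_mod_cast hle
  linarith

/-- Two vertices in different classes lie on a common transversal `τ`, which supplies both their
distinctness and their edge. -/
theorem contains_blowUp_of_box {k t : ℕ} {G : BicoloredGraph V} {F : BicoloredGraph (Fin k)}
    (g : Fin k → Fin t → V) (hg : ∀ i, Function.Injective (g i))
    (h : ∀ τ : Fin k → Fin t, Function.Injective (fun i => g i (τ i)) ∧
      (∀ u v, F.red.Adj u v → G.red.Adj (g u (τ u)) (g v (τ v))) ∧
      (∀ u v, F.blue.Adj u v → G.blue.Adj (g u (τ u)) (g v (τ v)))) :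
    G.Contains (F.blowUp t) := by
  have hτ : ∀ (i i' : Fin k) (j j' : Fin t), i ≠ i' → ∃ τ : Fin k → Fin t, τ i = j ∧ τ i' = j' :=
    fun i i' j j' hi => ⟨Function.update (fun _ => j') i j, by simp, by simp [hi.symm]⟩
  refine ⟨fun p => g p.1 p.2, ?_, ?_, ?_⟩
  · rintro ⟨i, j⟩ ⟨i', j'⟩ hp
    simp only at hp
    by_cases hi : i = i'
    · subst hi
      rw [hg i hp]
    · obtain ⟨τ, rfl, rfl⟩ := hτ i i' j j' hi
      exact absurd ((h τ).1 hp) hi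
  · rintro ⟨i, j⟩ ⟨i', j'⟩ hp
    have hp' : F.red.Adj i i' := hp
    obtain ⟨τ, rfl, rfl⟩ := hτ i i' j j' hp'.ne
    exact (h τ).2.1 _ _ hp'
  · rintro ⟨i, j⟩ ⟨i', j'⟩ hp
    have hp' : F.blue.Adj i i' := hp
    obtain ⟨τ, rfl, rfl⟩ := hτ i i' j j' hp'.ne
    exact (h τ).2.2 _ _ hp'

end BicoloredGraph

/-! ### Existence of the limit -/

open BicoloredGraph

theorem bddAbove_balancedEx (ε : ℝ) (n : ℕ) (𝓕 : Set FinBicoloredGraph) :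
    BddAbove {M : ℕ | ∃ G : BicoloredGraph (Fin n),
      G.IsBalanced ε ∧ M ≤ G.numEdges ∧ ∀ F ∈ 𝓕, ¬ G.Contains F.2} :=
  ⟨n.choose 2, fun _ ⟨G, _, hM, _⟩ => hM.trans (numEdges_le_choose n G)⟩

theorem numEdges_le_balancedEx {ε : ℝ} {n : ℕ} {𝓕 : Set FinBicoloredGraph}
    {G : BicoloredGraph (Fin n)} (hG : G.IsBalanced ε) (hF : ∀ F ∈ 𝓕, ¬ G.Contains F.2) :
    G.numEdges ≤ balancedEx ε n 𝓕 :=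
  le_csSup (bddAbove_balancedEx ε n 𝓕) ⟨G, hG, le_rfl, hF⟩

theorem balancedEx_eq_zero_or_exists (ε : ℝ) (n : ℕ) (𝓕 : Set FinBicoloredGraph) :
    balancedEx ε n 𝓕 = 0 ∨ ∃ G : BicoloredGraph (Fin n),
      G.IsBalanced ε ∧ balancedEx ε n 𝓕 ≤ G.numEdges ∧ ∀ F ∈ 𝓕, ¬ G.Contains F.2 := by
  rcases Set.eq_empty_or_nonempty {M : ℕ | ∃ G : BicoloredGraph (Fin n),
      G.IsBalanced ε ∧ M ≤ G.numEdges ∧ ∀ F ∈ 𝓕, ¬ G.Contains F.2} with h | h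
  · left; rw [balancedEx, h]; simp
  · right; exact Nat.sSup_mem h (bddAbove_balancedEx ε n 𝓕)

theorem balancedEx_div_choose_le_one (ε : ℝ) (n : ℕ) (𝓕 : Set FinBicoloredGraph) :
    (balancedEx ε n 𝓕 : ℝ) / (n.choose 2 : ℝ) ≤ 1 := by
  refine div_le_one_of_le₀ ?_ (Nat.cast_nonneg _)
  rcases balancedEx_eq_zero_or_exists ε n 𝓕 with h | ⟨G, -, h, -⟩
  · rw [h]; simp
  · exact_mod_cast h.trans (numEdges_le_choose n G)

/-- Letting `n` and then `m` tend to infinity gives `limsup u - η ≤ liminf u`. -/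
theorem exists_tendsto_of_eventually_eventually_sub_le {u : ℕ → ℝ} {a b : ℝ} (ha : ∀ n, a ≤ u n)
    (hb : ∀ n, u n ≤ b) (h : ∀ η : ℝ, 0 < η → ∀ᶠ m in atTop, ∀ᶠ n in atTop, u n - η ≤ u m) :
    ∃ c, Tendsto u atTop (𝓝 c) := by
  have hA : IsBoundedUnder (· ≤ ·) atTop u := isBoundedUnder_of ⟨b, hb⟩
  have hB : IsBoundedUnder (· ≥ ·) atTop u := isBoundedUnder_of ⟨a, ha⟩
  refine ⟨limsup u atTop, tendsto_of_le_liminf_of_limsup_le ?_ le_rfl hA hB⟩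
  refine le_of_forall_pos_le_add fun η hη => ?_
  rw [← sub_le_iff_le_add]
  refine le_liminf_of_le hA.isCoboundedUnder_ge ?_
  filter_upwards [h η hη] with m hm
  rw [sub_le_iff_le_add]
  refine limsup_le_of_le hB.isCoboundedUnder_le ?_
  filter_upwards [hm] with n hn
  linarith

theorem exists_tendsto_balancedEx_div_choose {ε : ℝ} (hε : 0 < ε) (𝓕 : Set FinBicoloredGraph) :
    ∃ c, Tendsto (fun n : ℕ => (balancedEx ε n 𝓕 : ℝ) / (n.choose 2 : ℝ)) atTop (𝓝 c) := by
  classical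
  refine exists_tendsto_of_eventually_eventually_sub_le (a := 0) (fun n => by positivity)
    (fun n => balancedEx_div_choose_le_one ε n 𝓕) fun η hη => ?_
  filter_upwards [eventually_half_le_card_dense_comap hε hη, eventually_ge_atTop 2] with m hm hm2
  filter_upwards [hm, eventually_gt_atTop 0] with n hn hn0
  rcases balancedEx_eq_zero_or_exists ε n 𝓕 with h | ⟨G, hG, hGe, hGF⟩
  · rw [h, Nat.cast_zero, zero_div, zero_sub]
    have : 0 ≤ (balancedEx ε m 𝓕 : ℝ) / (m.choose 2 : ℝ) := by positivity
    linarith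
  have hn0' : (0 : ℝ) < n := by exact_mod_cast hn0
  have hpos := lt_of_lt_of_le (by positivity) (hn G hG)
  obtain ⟨φ, hφ⟩ := Finset.card_pos.1 (Nat.cast_pos.1 hpos)
  obtain ⟨-, hinj, H, h1, h2, h3, h4⟩ := Finset.mem_filter.1 hφ
  have h5 : (H.numEdges : ℝ) ≤ balancedEx ε m 𝓕 := by
    exact_mod_cast numEdges_le_balancedEx h3
      fun F hF hc => hGF F hF (hc.of_le_comap hinj h1 h2)
  have h6 : (0 : ℝ) < m.choose 2 := by exact_mod_cast Nat.choose_pos hm2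
  rw [le_div_iff₀ h6]
  refine le_trans ?_ (h4.trans h5)
  gcongr

/-! ### Supersaturation and blow-ups -/

/-- The first conjunct says that the limit defining `ex(ε, 𝓕)` really exists. -/
theorem theorem3p4 (ε : ℝ) (hε : 0 < ε) (𝓕 : Set FinBicoloredGraph) (h𝓕 : 𝓕.Finite) :
    Tendsto (fun n : ℕ => (balancedEx ε n 𝓕 : ℝ) / (n.choose 2 : ℝ)) atTop
        (𝓝 (balancedExDensity ε 𝓕)) ∧
      ∀ δ : ℝ, 0 < δ → ∀ t : ℕ, ∃ N : ℕ, ∀ n : ℕ, N ≤ n →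
        ∀ G : BicoloredGraph (Fin n), G.IsBalanced ε →
          (balancedExDensity ε 𝓕 + δ) * (n.choose 2 : ℝ) ≤ (G.numEdges : ℝ) →
            ∃ F ∈ 𝓕, G.Contains (F.2.blowUp t) := by
  classical
  have hlim := tendsto_nhds_limUnder (exists_tendsto_balancedEx_div_choose hε 𝓕)
  change Tendsto _ _ (𝓝 (balancedExDensity ε 𝓕)) at hlim
  set c := balancedExDensity ε 𝓕
  refine ⟨hlim, fun δ hδ t => ?_⟩
  obtain ⟨m, hsample, hm, hm2⟩ := ((eventually_half_le_card_dense_comap hε (half_pos hδ)).and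
    ((hlim.eventually_lt_const (show c < c + δ / 2 by linarith)).and
      (eventually_ge_atTop 2))).exists
  have hm0 : (0 : ℝ) < m.choose 2 := by exact_mod_cast Nat.choose_pos hm2
  rw [div_lt_iff₀ hm0] at hm
  let P : Finset (Σ F : FinBicoloredGraph, Fin F.1 → Fin m) :=
    h𝓕.toFinset.sigma fun F => (Finset.univ : Finset (Fin F.1 → Fin m))
  -- The `+ 1` makes `P.card * γ < 1 / 2`, even for empty `P`, so the pigeonhole is strict.
  let γ : ℝ := 1 / (2 * (P.card + 1))
  have hγ : 0 < γ := by positivity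
  have hbox := (eventually_all_finite h𝓕).2
    fun F _ => eventually_exists_box_subset F.1 t hγ
  refine eventually_atTop.1 ?_
  filter_upwards [hsample, hbox, eventually_ge_atTop 2] with n hn hnbox hn2 G hG hGe
  have hn0 : (0 : ℝ) < n := by exact_mod_cast (by omega : 0 < n)
  have hnc : (0 : ℝ) < n.choose 2 := by exact_mod_cast Nat.choose_pos hn2
  rw [← le_div_iff₀ hnc] at hGe
  let A : ∀ F : FinBicoloredGraph, Finset (Fin F.1 → Fin n) := fun F =>
    Finset.univ.filter fun ψ => Function.Injective ψ ∧
      (∀ u v, F.2.red.Adj u v → G.red.Adj (ψ u) (ψ v)) ∧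
      (∀ u v, F.2.blue.Adj u v → G.blue.Adj (ψ u) (ψ v))
  let T : (Σ F : FinBicoloredGraph, Fin F.1 → Fin m) → Finset (Fin m → Fin n) := fun p =>
    Finset.univ.filter fun φ => Function.Injective p.2 ∧ φ ∘ p.2 ∈ A p.1
  have hS := hn G hG
  have hcover := Finset.card_le_card (t := P.biUnion T) (s := Finset.univ.filter
    fun φ : Fin m → Fin n => Function.Injective φ ∧
        ∃ H : BicoloredGraph (Fin m), H.red ≤ (G.comap φ).red ∧ H.blue ≤ (G.comap φ).blue ∧
          H.IsBalanced ε ∧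
          ((G.numEdges : ℝ) / n.choose 2 - δ / 2) * m.choose 2 ≤ H.numEdges) (by
    intro φ hφ
    obtain ⟨-, hinj, H, h1, h2, h3, h4⟩ := Finset.mem_filter.1 hφ
    have h5 : ∃ F ∈ 𝓕, H.Contains F.2 := by
      by_contra! hcon
      have h6 : (H.numEdges : ℝ) ≤ balancedEx ε m 𝓕 := by
        exact_mod_cast numEdges_le_balancedEx h3 hcon
      have h7 : (c + δ / 2) * m.choose 2 ≤
          ((G.numEdges : ℝ) / n.choose 2 - δ / 2) * m.choose 2 :=
        mul_le_mul_of_nonneg_right (by linarith) hm0.le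
      linarith
    obtain ⟨F, hF, f, hf, hfr, hfb⟩ := h5
    refine Finset.mem_biUnion.2 ⟨⟨F, f⟩, ?_, ?_⟩
    · simp [P, hF]
    · simp only [T, A, Finset.mem_filter, Finset.mem_univ, true_and]
      exact ⟨hf, hinj.comp hf, fun u v huv => h1 (hfr u v huv), fun u v huv => h2 (hfb u v huv)⟩)
  have hexists : ∃ p ∈ P, γ * (n : ℝ) ^ m < (T p).card := by
    by_contra! hcon
    have h1 : ((P.biUnion T).card : ℝ) ≤ P.card * (γ * (n : ℝ) ^ m) := by
      rw [← nsmul_eq_mul]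
      refine le_trans ?_ (Finset.sum_le_card_nsmul P _ _ hcon)
      exact_mod_cast Finset.card_biUnion_le
    have h2 : (n : ℝ) ^ m / 2 ≤ P.card * (γ * (n : ℝ) ^ m) :=
      hS.trans (le_trans (by exact_mod_cast hcover) h1)
    have h3 : γ * (P.card + 1) = 1 / 2 := by simp only [γ]; field_simp
    have h4 : 0 < γ * (n : ℝ) ^ m := by positivity
    nlinarith
  obtain ⟨⟨F, f⟩, hp, hT⟩ := hexists
  have hF : F ∈ 𝓕 := by simpa [P] using hp
  have hTpos : (0 : ℝ) < (T ⟨F, f⟩).card := lt_of_le_of_lt (by positivity) hT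
  obtain ⟨φ₀, hφ₀⟩ := Finset.card_pos.1 (Nat.cast_pos.1 hTpos)
  have hf : Function.Injective f := (Finset.mem_filter.1 hφ₀).2.1
  -- Restriction along `f` transfers the proportion of `T ⟨F, f⟩` among samples to `A F` among
  -- tuples.
  have hcount := sum_comp_mul_card_pow (V := Fin n) hf (fun ψ => if ψ ∈ A F then (1 : ℝ) else 0)
  have hTsum : ∑ φ : Fin m → Fin n, (if φ ∘ f ∈ A F then (1 : ℝ) else 0) = (T ⟨F, f⟩).card := by
    rw [Finset.sum_boole]
    simp [T, hf]
  rw [hTsum] at hcount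
  simp only [Fintype.card_fin, Finset.sum_boole, Finset.filter_univ_mem] at hcount
  have hAF : γ * (n : ℝ) ^ F.1 ≤ (A F).card := by
    have h1 : (n : ℝ) ^ m * (γ * (n : ℝ) ^ F.1) ≤ n ^ m * (A F).card := by
      rw [← hcount]
      have h2 : (0 : ℝ) ≤ (n : ℝ) ^ F.1 := by positivity
      nlinarith
    exact le_of_mul_le_mul_left h1 (by positivity)
  obtain ⟨g, hg, hgA⟩ := hnbox F hF (A F) hAF
  exact ⟨F, hF, contains_blowUp_of_box g hg fun τ => (Finset.mem_filter.1 (hgA τ)).2⟩
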